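/- Let $m$ be a positive even integer. There is a constant $K_m>0$, depending only on $m$, such that the following holds. Let $p\equiv m+1 \pmod{2m}$ be a prime, let $g$ be a primitive element of the field $\mathbb{F}_p$, and for $0\le i\le m-1$ let $S_i=\{g^t \mid t\in\mathbb{Z},\ t\equiv i \pmod m\}$. Let $(i_1,\dots,i_{m/2})\in\{0,1,\dots,m-1\}^{m/2}$ be such that the set $S=S_{i_1}\cup\cdots\cup S_{i_{m/2}}$ satisfies $\mathbb{F}_p^*\setminus S=-S$, and let $T=T_p^m(S)$ be the tournament with vertex set $\mathbb{F}_p$ and edge set $\{(x,y)\in\mathbb{F}_p^2 \mid x-y\in S\}$. For a bijection $\sigma:\mathbb{F}_p\to\{1,\dots,p\}$ let $C(T,\sigma)$ be the number of edges $(x,y)$ of $T$ with $\sigma(x)<\sigma(y)$, and let $C(T)=\max_\sigma C(T,\sigma)$. Then $$C(T)\le \frac12\binom p2+K_m\,p^{3/2}\log p .$$ -/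

import Mathlib

open scoped Pointwise

namespace CyclotomicTournament

/-- A digraph is a tournament if it has no loops and any two distinct vertices are joined by
an edge in exactly one of the two directions. -/
def IsTournament {V : Type*} (D : Digraph V) : Prop :=
  (∀ x, ¬ D.Adj x x) ∧ ∀ x y, x ≠ y → (D.Adj x y ↔ ¬ D.Adj y x)

/-- The number `C(D, σ)` of edges `(x, y)` of `D` that are consistent with the ranking `σ`,
that is, `σ x < σ y`. Rankings take values in `Fin n`, i.e. in `{0, …, n - 1}`, instead
of `{1, …, n}`. -/
noncomputable def consistentEdges {V : Type*} [Fintype V] (D : Digraph V)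
    (σ : V ≃ Fin (Fintype.card V)) : ℕ :=
  Set.ncard {e : V × V | D.Adj e.1 e.2 ∧ σ e.1 < σ e.2}

/-- The maximum `C(D)` of `C(D, σ)` over all rankings `σ`. -/
noncomputable def maxConsistentEdges {V : Type*} [Fintype V] [DecidableEq V]
    (D : Digraph V) : ℕ :=
  Finset.univ.sup (fun σ : V ≃ Fin (Fintype.card V) => consistentEdges D σ)

/-- The cyclotomic coset `S_i = {g ^ t | t ≡ i (mod m)}` of `𝔽_p`. -/
def cyclotomicCoset {p : ℕ} (m : ℕ) (g : (ZMod p)ˣ) (i : ℕ) : Set (ZMod p) :=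
  {x | ∃ t : ℤ, t ≡ (i : ℤ) [ZMOD (m : ℤ)] ∧ x = ((g ^ t : (ZMod p)ˣ) : ZMod p)}

/-- The union `S_{i_1} ∪ ⋯ ∪ S_{i_{m/2}}` of cyclotomic cosets. -/
def cosetUnion {p : ℕ} (m : ℕ) (g : (ZMod p)ˣ) (i : Fin (m / 2) → Fin m) : Set (ZMod p) :=
  ⋃ k, cyclotomicCoset m g (i k)

/-- The digraph on `𝔽_p` whose edges are the pairs `(x, y)` with `x - y ∈ S`. -/
def differenceDigraph {p : ℕ} (S : Set (ZMod p)) : Digraph (ZMod p) where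
  Adj x y := x - y ∈ S

/-- If `𝔽_p^* \ S = -S`, the digraph above is a tournament. -/
theorem isTournament_differenceDigraph {p : ℕ} {S : Set (ZMod p)} (h0 : (0 : ZMod p) ∉ S)
    (hS : {x : ZMod p | x ≠ 0} \ S = -S) : IsTournament (differenceDigraph S) := by
  refine ⟨fun x => by simpa [differenceDigraph] using h0, fun x y hxy => ?_⟩
  have h := Set.ext_iff.1 hS (y - x)
  simp only [Set.mem_sdiff, Set.mem_ofPred_eq, Set.mem_neg, neg_sub, ne_eq, sub_eq_zero] at h
  have hne : ¬ y = x := fun e => hxy e.symm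
  simp only [differenceDigraph]
  tauto

/-- The cyclotomic cosets do not contain `0`. -/
theorem zero_notMem_cosetUnion {p : ℕ} [Fact p.Prime] (m : ℕ) (g : (ZMod p)ˣ)
    (i : Fin (m / 2) → Fin m) : (0 : ZMod p) ∉ cosetUnion m g i := by
  simp only [cosetUnion, cyclotomicCoset, Set.mem_iUnion, Set.mem_ofPred_eq, not_exists, not_and]
  intro _ t _ h
  exact (g ^ t).ne_zero h.symm

end CyclotomicTournament

/-!
Write `S` for the union of cosets. Counting the edges consistent with a ranking `σ` amounts to
summing the indicator of `S` over all differences `x - y` with `σ x < σ y`. Let `χ` be the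
multiplicative character of order `m` sending `g` to a primitive `m`-th root of unity. Membership
of `x ≠ 0` in `S` depends only on `χ x`, so the indicator of `S` is a combination
`∑ j < m, c j * χ ^ j` with `‖c j‖ ≤ 1` (`ite_mem_cosetUnion_eq_sum`). Since `S` and `-S`
partition the nonzero elements, `c 0 = 1 / 2`, and the trivial character contributes exactly
`1 / 2 * p.choose 2`. It remains to see that every nontrivial character `ψ` contributes
`O(p ^ (3 / 2) * log p)`.

No Gauss sums are needed for this. The translates of `ψ` are almost orthogonal
(`sum_sub_mul_inv_sub_eq_neg_one`, a Jacobi sum), so Cauchy–Schwarz bounds the sum of `ψ (x - y)`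
over a rectangle `A × B` by `√p * √(#A * #B)` (`norm_sum_sum_sub_le`). The set of pairs with
`σ x < σ y` is a half-square, which is cut dyadically into rectangles: at each of the
`O(log p)` scales the rectangles contribute `O(√p * p)` altogether (`norm_sum_dyadic_le`).
-/

namespace CyclotomicTournament

/-! ### Sums of a nontrivial character over rectangles -/

section Rectangle

variable {F : Type*} [Field F] [Fintype F]

theorem sum_sub_mul_inv_sub_eq_neg_one {χ : MulChar F ℂ} (hχ : χ ≠ 1) {b c : F} (hbc : b ≠ c) :
    ∑ a, χ (a - b) * χ⁻¹ (a - c) = -1 := by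
  have hd : c - b ≠ 0 := sub_ne_zero.2 hbc.symm
  have hinv : ∀ {x : F}, x ≠ 0 → χ x * χ⁻¹ x = 1 := fun {x} hx => by
    rw [← MulChar.mul_apply, mul_inv_cancel, MulChar.one_apply hx.isUnit]
  have hJ := jacobiSum_nontrivial_inv hχ
  rw [jacobiSum] at hJ
  -- The affine substitution `a = b + (c - b) * x` turns the sum into a multiple of `J(χ, χ⁻¹)`.
  calc ∑ a, χ (a - b) * χ⁻¹ (a - c)
      = ∑ x, χ ((c - b) * x + b - b) * χ⁻¹ ((c - b) * x + b - c) :=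
        (((Equiv.mulLeft₀ (c - b) hd).trans (Equiv.addRight b)).sum_comp
          (fun a => χ (a - b) * χ⁻¹ (a - c))).symm
    _ = ∑ x, χ (c - b) * χ⁻¹ (c - b) * χ⁻¹ (-1) * (χ x * χ⁻¹ (1 - x)) := by
        refine Finset.sum_congr rfl fun x _ => ?_
        rw [show (c - b) * x + b - b = (c - b) * x by ring,
          show (c - b) * x + b - c = (c - b) * ((-1) * (1 - x)) by ring,
          map_mul, map_mul, map_mul]
        ring
    _ = -1 := by
        rw [← Finset.mul_sum, hJ, hinv hd]
        linear_combination -hinv (x := (-1 : F)) (by simp)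

theorem sum_sub_mul_inv_sub_self (χ : MulChar F ℂ) (b : F) :
    ∑ a, χ (a - b) * χ⁻¹ (a - b) = (Fintype.card F : ℂ) - 1 := by
  classical
  refine (Fintype.sum_equiv (Equiv.subRight b) _ (fun a => χ a * χ⁻¹ a) fun a => rfl).trans ?_
  simp only [← MulChar.mul_apply, mul_inv_cancel]
  rw [MulChar.sum_one_eq_card_units, Fintype.card_units, Nat.cast_sub Fintype.card_pos,
    Nat.cast_one]

theorem sum_norm_sum_sub_sq_le {χ : MulChar F ℂ} (hχ : χ ≠ 1) (B : Finset F) :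
    ∑ a, ‖∑ b ∈ B, χ (a - b)‖ ^ 2 ≤ Fintype.card F * B.card := by
  classical
  have key : ((∑ a, ‖∑ b ∈ B, χ (a - b)‖ ^ 2 : ℝ) : ℂ)
      = Fintype.card F * B.card - B.card ^ 2 := by
    push_cast
    calc ∑ a, (‖∑ b ∈ B, χ (a - b)‖ : ℂ) ^ 2
        = ∑ a, ∑ b ∈ B, ∑ c ∈ B, χ (a - b) * χ⁻¹ (a - c) := by
          refine Finset.sum_congr rfl fun a _ => ?_
          rw [← Complex.mul_conj', map_sum, Finset.sum_mul_sum]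
          simp only [starRingEnd_apply, MulChar.star_apply']
      _ = ∑ b ∈ B, ∑ c ∈ B, ∑ a, χ (a - b) * χ⁻¹ (a - c) := by
          rw [Finset.sum_comm]
          exact Finset.sum_congr rfl fun b _ => Finset.sum_comm
      _ = ∑ b ∈ B, ∑ c ∈ B, ((if b = c then (Fintype.card F : ℂ) else 0) - 1) := by
          refine Finset.sum_congr rfl fun b _ => Finset.sum_congr rfl fun c _ => ?_
          split_ifs with h
          · rw [← h, sum_sub_mul_inv_sub_self]
          · rw [sum_sub_mul_inv_sub_eq_neg_one hχ h, zero_sub]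
      _ = Fintype.card F * B.card - B.card ^ 2 := by
          simp [Finset.sum_sub_distrib, Finset.sum_ite_eq]
          ring
  have key' : ∑ a, ‖∑ b ∈ B, χ (a - b)‖ ^ 2 = (Fintype.card F * B.card - B.card ^ 2 : ℝ) := by
    exact_mod_cast key
  rw [key']
  linarith [sq_nonneg (B.card : ℝ)]

/-- A nontrivial multiplicative character of a finite field has small discrepancy on rectangles. -/
theorem norm_sum_sum_sub_le {χ : MulChar F ℂ} (hχ : χ ≠ 1) (A B : Finset F) :
    ‖∑ a ∈ A, ∑ b ∈ B, χ (a - b)‖ ≤ √(Fintype.card F) * √(A.card * B.card) := by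
  rw [← Real.sqrt_mul (by positivity)]
  refine Real.le_sqrt_of_sq_le ?_
  calc ‖∑ a ∈ A, ∑ b ∈ B, χ (a - b)‖ ^ 2
      ≤ (∑ a ∈ A, ‖∑ b ∈ B, χ (a - b)‖) ^ 2 := by
        gcongr
        exact norm_sum_le _ _
    _ ≤ A.card * ∑ a ∈ A, ‖∑ b ∈ B, χ (a - b)‖ ^ 2 := sq_sum_le_card_mul_sum_sq
    _ ≤ A.card * ∑ a, ‖∑ b ∈ B, χ (a - b)‖ ^ 2 := by
        gcongr
        exact Finset.subset_univ A
    _ ≤ A.card * (Fintype.card F * B.card) := by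
        gcongr
        exact sum_norm_sum_sub_sq_le hχ B
    _ = Fintype.card F * (A.card * B.card) := by ring

end Rectangle

/-! ### From rectangles to half-squares -/

section Dyadic

variable {ι : Type*} [Fintype ι] {σ : ι → ℕ}

theorem card_filter_Ico_le (hσ : Function.Injective σ) (a n : ℕ) :
    (Finset.univ.filter fun x => σ x ∈ Finset.Ico a (a + n)).card ≤ n := by
  calc _ ≤ (Finset.Ico a (a + n)).card :=
        Finset.card_le_card_of_injOn σ (fun x hx => by simpa using hx) hσ.injOn
    _ = n := by simp

/-- If a kernel `M` has discrepancy at most `L * √(#A * #B)` on every rectangle, then its sum over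
the pairs ordered by `σ` inside a window of length `2 ^ k` is at most `L * k * 2 ^ k`: the window
is halved, the pairs separated by the halving form a single rectangle, and each half is handled
by induction. -/
theorem norm_sum_dyadic_le (hσ : Function.Injective σ) {M : ι → ι → ℂ} {L : ℝ} (hL : 0 ≤ L)
    (hM : ∀ A B : Finset ι, ‖∑ x ∈ A, ∑ y ∈ B, M x y‖ ≤ L * √(A.card * B.card)) (k a : ℕ) :
    ‖∑ x with σ x ∈ Finset.Ico a (a + 2 ^ k), ∑ y with σ y ∈ Finset.Ico a (a + 2 ^ k),
      if σ x < σ y then M x y else 0‖ ≤ L * k * 2 ^ k := by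
  classical
  induction k generalizing a with
  | zero =>
    rw [Finset.sum_eq_zero]
    · simp
    · intro x hx
      refine Finset.sum_eq_zero fun y hy => if_neg ?_
      simp at hx hy
      omega
  | succ k ih =>
    set W : ℕ → Finset ι := fun b => Finset.univ.filter fun x => σ x ∈ Finset.Ico b (b + 2 ^ k)
      with hW
    have hsplit : (Finset.univ.filter fun x => σ x ∈ Finset.Ico a (a + 2 ^ (k + 1)))
        = W a ∪ W (a + 2 ^ k) := by
      ext x
      simp only [hW, Finset.mem_union, Finset.mem_filter, Finset.mem_univ, true_and,
        Finset.mem_Ico, pow_succ]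
      omega
    have hdisj : Disjoint (W a) (W (a + 2 ^ k)) := by
      rw [Finset.disjoint_left]
      intro x hx hx'
      simp [hW] at hx hx'
      omega
    have hcross : ∑ x ∈ W a, ∑ y ∈ W (a + 2 ^ k), (if σ x < σ y then M x y else 0)
        = ∑ x ∈ W a, ∑ y ∈ W (a + 2 ^ k), M x y := by
      refine Finset.sum_congr rfl fun x hx => Finset.sum_congr rfl fun y hy => if_pos ?_
      simp [hW] at hx hy
      omega
    have hzero : ∑ x ∈ W (a + 2 ^ k), ∑ y ∈ W a, (if σ x < σ y then M x y else 0) = 0 := by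
      refine Finset.sum_eq_zero fun x hx => Finset.sum_eq_zero fun y hy => if_neg ?_
      simp [hW] at hx hy
      omega
    have hc : ∀ b, ((W b).card : ℝ) ≤ 2 ^ k := fun b => by
      exact_mod_cast card_filter_Ico_le hσ b (2 ^ k)
    have hbound : ‖∑ x ∈ W a, ∑ y ∈ W (a + 2 ^ k), M x y‖ ≤ L * 2 ^ k := by
      refine (hM _ _).trans (mul_le_mul_of_nonneg_left ?_ hL)
      refine Real.sqrt_le_iff.2 ⟨by positivity, ?_⟩
      rw [sq]
      exact mul_le_mul (hc _) (hc _) (by positivity) (by positivity)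
    rw [hsplit, Finset.sum_union hdisj]
    simp only [Finset.sum_union hdisj, Finset.sum_add_distrib]
    rw [hcross, hzero, zero_add]
    have h1 := ih a
    have h2 := ih (a + 2 ^ k)
    have hp : 0 ≤ L * 2 ^ k := by positivity
    refine (norm_add_le _ _).trans ?_
    refine (add_le_add (norm_add_le _ _) le_rfl).trans ?_
    push_cast
    rw [pow_succ]
    linarith [h1, h2, hbound]

theorem two_pow_clog_le {n : ℕ} (hn : 1 < n) : 2 ^ Nat.clog 2 n ≤ 2 * n := by
  have h := Nat.pow_pred_clog_lt_self (b := 2) (by norm_num) hn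
  have hpos : 0 < Nat.clog 2 n := Nat.clog_pos (by norm_num) hn
  obtain ⟨k, hk⟩ := Nat.exists_eq_succ_of_ne_zero hpos.ne'
  rw [hk] at h ⊢
  rw [Nat.pred_succ] at h
  rw [pow_succ]
  omega

theorem clog_two_le_four_mul_log {n : ℕ} (hn : 1 < n) : (Nat.clog 2 n : ℝ) ≤ 4 * Real.log n := by
  have h : ((2 : ℝ) ^ Nat.clog 2 n) ≤ n ^ 2 := by
    have h' : 2 ^ Nat.clog 2 n ≤ n ^ 2 := (two_pow_clog_le hn).trans (by nlinarith)
    exact_mod_cast h'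
  have h2 := Real.log_le_log (by positivity) h
  rw [Real.log_pow, Real.log_pow] at h2
  have h3 : (1 / 2 : ℝ) ≤ Real.log 2 := by linarith [Real.log_two_gt_d9]
  have h4 : (Nat.clog 2 n : ℝ) * (1 / 2) ≤ Nat.clog 2 n * Real.log 2 := by gcongr
  push_cast at h2
  linarith

theorem norm_sum_sum_lt_le {n : ℕ} (hn : 1 < n) (σ : ι ≃ Fin n)
    {M : ι → ι → ℂ} {L : ℝ} (hL : 0 ≤ L)
    (hM : ∀ A B : Finset ι, ‖∑ x ∈ A, ∑ y ∈ B, M x y‖ ≤ L * √(A.card * B.card)) :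
    ‖∑ x, ∑ y, if σ x < σ y then M x y else 0‖
      ≤ 8 * L * (n * Real.log n) := by
  have hσ : Function.Injective fun x => (σ x : ℕ) := Fin.val_injective.comp σ.injective
  have h := norm_sum_dyadic_le hσ hL hM (Nat.clog 2 n) 0
  have huniv : (Finset.univ.filter fun x => (σ x : ℕ) ∈ Finset.Ico 0 (0 + 2 ^ Nat.clog 2 n))
      = Finset.univ := by
    refine Finset.filter_true_of_mem fun x _ => ?_
    have := (σ x).isLt.trans_le (Nat.le_pow_clog (b := 2) (by norm_num) n)
    simpa using this
  rw [huniv] at h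
  simp only [Fin.val_fin_lt] at h
  have h2 : ((2 : ℝ) ^ Nat.clog 2 n) ≤ 2 * n := by exact_mod_cast two_pow_clog_le hn
  have h4 := clog_two_le_four_mul_log hn
  calc _ ≤ L * Nat.clog 2 n * 2 ^ Nat.clog 2 n := h
    _ ≤ L * (4 * Real.log n) * (2 * n) := by gcongr
    _ = _ := by ring

end Dyadic

/-! ### Counting consistent edges -/

theorem sum_sum_ite_lt_eq_choose {ι : Type*} [Fintype ι] (σ : ι ≃ Fin (Fintype.card ι)) :
    ∑ x, ∑ y, (if σ x < σ y then (1 : ℂ) else 0) = ((Fintype.card ι).choose 2 : ℂ) := by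
  classical
  have h : ∑ x, ∑ y, (if σ x < σ y then 1 else 0) = (Fintype.card ι).choose 2 := by
    rw [Finset.sum_comm, Nat.choose_two_right, ← Finset.sum_range_id,
      ← Fin.sum_univ_eq_sum_range (fun k => k), ← σ.sum_comp]
    refine Finset.sum_congr rfl fun y _ => ?_
    rw [σ.sum_comp (fun a => if a < σ y then 1 else 0), ← Finset.card_filter]
    rw [← Fin.card_Iio (σ y)]
    congr 1
    ext a
    simp
  exact_mod_cast h

open Classical in
theorem consistentEdges_eq_sum {V : Type*} [Fintype V] (D : Digraph V)
    (σ : V ≃ Fin (Fintype.card V)) :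
    (consistentEdges D σ : ℂ)
      = ∑ x, ∑ y, if σ x < σ y then (if D.Adj x y then (1 : ℂ) else 0) else 0 := by
  rw [consistentEdges, Set.ncard_eq_toFinset_card', ← Finset.sum_product',
    Finset.cast_card, Finset.univ_product_univ, ← Finset.sum_filter_add_sum_filter_not
      (s := Finset.univ) (p := fun e : V × V => D.Adj e.1 e.2 ∧ σ e.1 < σ e.2),
    Finset.sum_eq_zero (s := Finset.univ.filter fun e : V × V => ¬ _), add_zero]
  · refine Finset.sum_congr (by ext; simp) fun e he => ?_
    simp only [Finset.mem_filter] at he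
    simp [he]
  · intro e he
    simp only [Finset.mem_filter, Finset.mem_univ, true_and] at he
    split_ifs <;> tauto

/-! ### Expanding the indicator of a union of cosets in characters -/

section Expansion

variable {p : ℕ} [Fact p.Prime] {m : ℕ} {g : (ZMod p)ˣ}

theorem mem_cyclotomicCoset_iff (hg : ∀ u : (ZMod p)ˣ, u ∈ Subgroup.zpowers g) {ω : ℂ}
    (hω : IsPrimitiveRoot ω m) (hm : 0 < m) {χ : MulChar (ZMod p) ℂ} (hχ : χ g = ω)
    {x : ZMod p} (hx : x ≠ 0) (r : ℕ) : x ∈ cyclotomicCoset m g r ↔ χ x = ω ^ r := by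
  have hω0 : ω ≠ 0 := hω.ne_zero hm.ne'
  have hpow : ∀ t : ℤ, χ ((g ^ t : (ZMod p)ˣ) : ZMod p) = ω ^ t := fun t => by
    rw [← MulChar.coe_toUnitHom, map_zpow, Units.val_zpow_eq_zpow_val, MulChar.coe_toUnitHom, hχ]
  have hmod : ∀ t : ℤ, t ≡ (r : ℤ) [ZMOD (m : ℤ)] ↔ ω ^ t = ω ^ r := fun t => by
    rw [← zpow_natCast, ← div_eq_one_iff_eq (zpow_ne_zero _ hω0), ← zpow_sub₀ hω0,
      hω.zpow_eq_one_iff_dvd, ← Int.modEq_iff_dvd]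
    exact ⟨Int.ModEq.symm, Int.ModEq.symm⟩
  constructor
  · rintro ⟨t, ht, rfl⟩
    rw [hpow, (hmod t).1 ht]
  · intro h
    obtain ⟨t, ht⟩ := Subgroup.mem_zpowers_iff.1 (hg (Units.mk0 x hx))
    have hxt : x = ((g ^ t : (ZMod p)ˣ) : ZMod p) := by rw [ht, Units.val_mk0]
    exact ⟨t, (hmod t).2 (by rw [← hpow, ← hxt, h]), hxt⟩

/-- Orthogonality for the cyclic group of `m`-th roots of unity. -/
theorem sum_range_pow_of_pow_eq_one (hm : 0 < m) {z : ℂ} (hz : z ^ m = 1) :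
    (∑ j ∈ Finset.range m, z ^ j) / m = if z = 1 then 1 else 0 := by
  split_ifs with h
  · have : (m : ℂ) ≠ 0 := by exact_mod_cast hm.ne'
    simp [h, this]
  · have h' := mul_neg_geom_sum z m
    rw [hz, sub_self] at h'
    rw [(mul_eq_zero.1 h').resolve_left (sub_ne_zero.2 (Ne.symm h)), zero_div]

open Classical in
theorem ite_mem_cosetUnion_eq_sum (hg : ∀ u : (ZMod p)ˣ, u ∈ Subgroup.zpowers g) {ω : ℂ}
    (hω : IsPrimitiveRoot ω m) (hm : 0 < m) {χ : MulChar (ZMod p) ℂ} (hχ : χ g = ω)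
    (i : Fin (m / 2) → Fin m) :
    ∃ c : ℕ → ℂ, (∀ j, ‖c j‖ ≤ 1) ∧ ∀ x : ZMod p,
      (if x ∈ cosetUnion m g i then (1 : ℂ) else 0)
        = ∑ j ∈ Finset.range m, c j * (χ ^ j) x := by
  -- `J` is the set of values that `χ` takes on the union.
  set J : Finset ℂ := Finset.univ.image fun k => ω ^ (i k : ℕ) with hJ
  have hJpow : ∀ ζ ∈ J, ζ ^ m = 1 := by
    intro ζ hζ
    obtain ⟨k, -, rfl⟩ := Finset.mem_image.1 hζ
    rw [← pow_mul, mul_comm, pow_mul, hω.pow_eq_one, one_pow]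
  have hcard : (J.card : ℝ) ≤ m := by
    have : J.card ≤ m := Finset.card_image_le.trans (by simpa using Nat.div_le_self m 2)
    exact_mod_cast this
  refine ⟨fun j => (∑ ζ ∈ J, ζ⁻¹ ^ j) / m, fun j => ?_, fun x => ?_⟩
  · rw [norm_div, Complex.norm_natCast]
    refine div_le_one_of_le₀ ((norm_sum_le _ _).trans ?_) (by positivity)
    refine (Finset.sum_le_sum (g := fun _ => (1 : ℝ)) fun ζ hζ => ?_).trans (by simpa using hcard)
    rw [norm_pow, norm_inv, Complex.norm_eq_one_of_pow_eq_one (hJpow ζ hζ) hm.ne']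
    simp
  · rcases eq_or_ne x 0 with rfl | hx
    · rw [if_neg (zero_notMem_cosetUnion m g i), Finset.sum_eq_zero]
      intro j _
      rw [MulChar.map_zero, mul_zero]
    have hmem : x ∈ cosetUnion m g i ↔ χ x ∈ J := by
      simp [cosetUnion, hJ, mem_cyclotomicCoset_iff hg hω hm hχ hx, eq_comm]
    have hxm : χ x ^ m = 1 := by
      obtain ⟨t, ht⟩ := Subgroup.mem_zpowers_iff.1 (hg (Units.mk0 x hx))
      have : χ x = ω ^ t := by
        rw [← Units.val_mk0 hx, ← ht, ← MulChar.coe_toUnitHom, map_zpow,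
          Units.val_zpow_eq_zpow_val, MulChar.coe_toUnitHom, hχ]
      rw [this, ← zpow_natCast, ← zpow_mul, mul_comm, zpow_mul, zpow_natCast, hω.pow_eq_one,
        one_zpow]
    have hpow : ∀ j, (χ ^ j) x = χ x ^ j := fun j => by
      have h := MulChar.pow_apply_coe χ j (Units.mk0 x hx)
      rwa [Units.val_mk0] at h
    calc (if x ∈ cosetUnion m g i then (1 : ℂ) else 0)
        = ∑ ζ ∈ J, if ζ⁻¹ * χ x = 1 then 1 else 0 := by
          simp only [hmem]
          rw [← Finset.sum_ite_eq' J (χ x) (fun _ => (1 : ℂ))]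
          refine Finset.sum_congr rfl fun ζ hζ => ?_
          have hζ0 : ζ ≠ 0 := fun h => by simpa [h, hm.ne'] using hJpow ζ hζ
          simp only [inv_mul_eq_one₀ hζ0]
      _ = ∑ ζ ∈ J, (∑ j ∈ Finset.range m, (ζ⁻¹ * χ x) ^ j) / m := by
          refine Finset.sum_congr rfl fun ζ hζ => ?_
          rw [sum_range_pow_of_pow_eq_one hm]
          rw [mul_pow, inv_pow, hJpow ζ hζ, hxm, inv_one, one_mul]
      _ = _ := by
          simp only [hpow, mul_pow]
          rw [← Finset.sum_div, Finset.sum_comm, Finset.sum_div]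
          refine Finset.sum_congr rfl fun j _ => ?_
          rw [← Finset.sum_mul]
          ring

theorem exists_mulChar_apply_eq (hg : ∀ u : (ZMod p)ˣ, u ∈ Subgroup.zpowers g) {ω : ℂ}
    (hω : IsPrimitiveRoot ω m) (hm : 0 < m) (hmp : m ∣ p - 1) :
    ∃ χ : MulChar (ZMod p) ℂ, χ g = ω := by
  obtain ⟨u, rfl⟩ := hω.isUnit hm.ne'
  have hu : u ∈ rootsOfUnity (Fintype.card (ZMod p)ˣ) ℂ := by
    rw [mem_rootsOfUnity, ZMod.card_units]
    obtain ⟨d, hd⟩ := hmp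
    refine Units.ext ?_
    rw [hd, Units.val_pow_eq_pow_val, pow_mul, hω.pow_eq_one, one_pow, Units.val_one]
  exact ⟨MulChar.ofRootOfUnity hu hg, MulChar.ofRootOfUnity_spec hu hg⟩

theorem pow_ne_one_of_apply_eq {ω : ℂ} (hω : IsPrimitiveRoot ω m) {χ : MulChar (ZMod p) ℂ}
    (hχ : χ g = ω) {j : ℕ} (hj0 : j ≠ 0) (hj : j < m) : χ ^ j ≠ 1 := by
  intro h
  have h1 := MulChar.pow_apply_coe χ j g
  rw [h, MulChar.one_apply_coe, hχ] at h1
  exact hω.pow_ne_one_of_pos_of_lt hj0 hj h1.symm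

open Classical in
/-- If `S` and `-S` partition the nonzero elements, then the coefficient of the trivial character
in the indicator of `S` is `1 / 2`. -/
theorem coeff_zero_eq_half {S : Set (ZMod p)} (hS0 : (0 : ZMod p) ∉ S)
    (hS : {x : ZMod p | x ≠ 0} \ S = -S) (hm : 0 < m) {χ : MulChar (ZMod p) ℂ}
    (hχ : ∀ j, j ≠ 0 → j < m → χ ^ j ≠ 1) {c : ℕ → ℂ}
    (hc : ∀ x, (if x ∈ S then (1 : ℂ) else 0) = ∑ j ∈ Finset.range m, c j * (χ ^ j) x) :
    c 0 = 1 / 2 := by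
  have hunits : ∑ x : ZMod p, (1 : MulChar (ZMod p) ℂ) x = (p : ℂ) - 1 := by
    rw [MulChar.sum_one_eq_card_units, ZMod.card_units,
      Nat.cast_sub (Fact.out : p.Prime).one_le, Nat.cast_one]
  have hsum : ∑ x : ZMod p, (if x ∈ S then (1 : ℂ) else 0) = c 0 * ((p : ℂ) - 1) := by
    simp only [hc]
    rw [Finset.sum_comm, Finset.sum_eq_single_of_mem 0 (Finset.mem_range.2 hm)]
    · rw [← Finset.mul_sum, pow_zero, hunits]
    · intro j hj hj0
      rw [← Finset.mul_sum, MulChar.sum_eq_zero_of_ne_one (hχ j hj0 (Finset.mem_range.1 hj)),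
        mul_zero]
  have hneg : ∑ x : ZMod p, (if -x ∈ S then (1 : ℂ) else 0) = c 0 * ((p : ℂ) - 1) := by
    rw [← hsum]
    exact Fintype.sum_equiv (Equiv.neg (ZMod p)) _ (fun x => if x ∈ S then (1 : ℂ) else 0)
      fun x => rfl
  have hadd : ∀ x : ZMod p, (if x ∈ S then (1 : ℂ) else 0) + (if -x ∈ S then (1 : ℂ) else 0)
      = (1 : MulChar (ZMod p) ℂ) x := by
    intro x
    have h := Set.ext_iff.1 hS x
    simp only [Set.mem_sdiff, Set.mem_ofPred_eq, Set.mem_neg] at h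
    rcases eq_or_ne x 0 with rfl | hx
    · simp [hS0, MulChar.map_zero]
    · rw [MulChar.one_apply hx.isUnit]
      by_cases hxS : x ∈ S
      · simp [hxS, show -x ∉ S by tauto]
      · simp [hxS, show -x ∈ S by tauto]
  have htot : c 0 * ((p : ℂ) - 1) + c 0 * ((p : ℂ) - 1) = (p : ℂ) - 1 := by
    have h := Finset.sum_congr (rfl : (Finset.univ : Finset (ZMod p)) = _) fun x _ => hadd x
    rwa [Finset.sum_add_distrib, hsum, hneg, hunits] at h
  have hp : (p : ℂ) - 1 ≠ 0 :=
    sub_ne_zero.2 (by exact_mod_cast (Fact.out : p.Prime).one_lt.ne')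
  have h2 : (2 * c 0) * ((p : ℂ) - 1) = 1 * ((p : ℂ) - 1) := by linear_combination htot
  linear_combination (1 / 2 : ℂ) * mul_right_cancel₀ hp h2

end Expansion

/-! ### The bound for a single ranking -/

theorem consistentEdges_cosetUnion_le {p : ℕ} [Fact p.Prime] {m : ℕ} {g : (ZMod p)ˣ}
    (hm : 0 < m) (hmp : m ∣ p - 1) (hg : ∀ u : (ZMod p)ˣ, u ∈ Subgroup.zpowers g)
    (i : Fin (m / 2) → Fin m)
    (hS : {x : ZMod p | x ≠ 0} \ cosetUnion m g i = -cosetUnion m g i)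
    (σ : ZMod p ≃ Fin (Fintype.card (ZMod p))) :
    (consistentEdges (differenceDigraph (cosetUnion m g i)) σ : ℝ)
      ≤ 1 / 2 * (p.choose 2 : ℝ) + 8 * m * (p : ℝ) ^ (3 / 2 : ℝ) * Real.log p := by
  classical
  have hω := Complex.isPrimitiveRoot_exp m hm.ne'
  obtain ⟨χ, hχ⟩ := exists_mulChar_apply_eq hg hω hm hmp
  obtain ⟨c, hc1, hc⟩ := ite_mem_cosetUnion_eq_sum hg hω hm hχ i
  have hχ1 : ∀ j, j ≠ 0 → j < m → χ ^ j ≠ 1 := fun j => pow_ne_one_of_apply_eq hω hχ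
  have hc0 := coeff_zero_eq_half (zero_notMem_cosetUnion m g i) hS hm hχ1 hc
  have hcard : Fintype.card (ZMod p) = p := ZMod.card p
  have hp1 : 1 < Fintype.card (ZMod p) := hcard.symm ▸ (Fact.out : p.Prime).one_lt
  set E : ℕ → ℂ := fun j => ∑ x, ∑ y, if σ x < σ y then (χ ^ j) (x - y) else 0 with hE
  have hE0 : E 0 = (p.choose 2 : ℂ) := by
    rw [← congrArg (fun n => (n.choose 2 : ℂ)) hcard, ← sum_sum_ite_lt_eq_choose σ]
    refine Finset.sum_congr rfl fun x _ => Finset.sum_congr rfl fun y _ => ?_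
    refine if_ctx_congr Iff.rfl (fun h => ?_) fun _ => rfl
    have hxy : x - y ≠ 0 := sub_ne_zero.2 fun e => h.ne (congrArg σ e)
    rw [pow_zero, MulChar.one_apply hxy.isUnit]
  have hEj : ∀ j, j ≠ 0 → j < m → ‖E j‖ ≤ 8 * √p * (p * Real.log p) := by
    intro j hj0 hj
    have h := norm_sum_sum_lt_le hp1 σ (Real.sqrt_nonneg _)
      (norm_sum_sum_sub_le (hχ1 j hj0 hj))
    exact h.trans_eq (by rw [hcard])
  have hcount : (consistentEdges (differenceDigraph (cosetUnion m g i)) σ : ℂ)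
      = ∑ j ∈ Finset.range m, c j * E j := by
    rw [consistentEdges_eq_sum]
    symm
    simp only [hE, Finset.mul_sum]
    rw [Finset.sum_comm]
    refine Finset.sum_congr rfl fun x _ => ?_
    rw [Finset.sum_comm]
    refine Finset.sum_congr rfl fun y _ => ?_
    split_ifs with h hS
    · exact (hc (x - y)).symm.trans (if_pos hS)
    · exact (hc (x - y)).symm.trans (if_neg hS)
    · simp
  have hdiff : (((consistentEdges (differenceDigraph (cosetUnion m g i)) σ : ℝ)
      - 1 / 2 * (p.choose 2 : ℝ) : ℝ) : ℂ) = ∑ j ∈ (Finset.range m).erase 0, c j * E j := by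
    push_cast
    rw [hcount, ← Finset.add_sum_erase _ _ (Finset.mem_range.2 hm), hc0, hE0, add_sub_cancel_left]
  have hlog : 0 ≤ Real.log p := Real.log_natCast_nonneg p
  have hbound : ‖∑ j ∈ (Finset.range m).erase 0, c j * E j‖ ≤ m * (8 * √p * (p * Real.log p)) := by
    refine (norm_sum_le _ _).trans ?_
    refine (Finset.sum_le_sum (g := fun _ => 8 * √p * (p * Real.log p)) fun j hj => ?_).trans ?_
    · obtain ⟨hj0, hj⟩ := Finset.mem_erase.1 hj
      rw [norm_mul]
      calc ‖c j‖ * ‖E j‖ ≤ 1 * (8 * √p * (p * Real.log p)) :=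
            mul_le_mul (hc1 j) (hEj j hj0 (Finset.mem_range.1 hj)) (norm_nonneg _) zero_le_one
        _ = _ := one_mul _
    · rw [Finset.sum_const, nsmul_eq_mul]
      gcongr
      exact (Finset.card_erase_le).trans_eq (Finset.card_range m)
  rw [← hdiff, Complex.norm_real] at hbound
  have hpow : (p : ℝ) ^ (3 / 2 : ℝ) = √p * p := by
    have hp0 : (0 : ℝ) < p := by exact_mod_cast (Fact.out : p.Prime).pos
    rw [Real.sqrt_eq_rpow, show (3 / 2 : ℝ) = 1 / 2 + 1 by norm_num, Real.rpow_add hp0,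
      Real.rpow_one]
  rw [hpow]
  linarith [(Real.le_norm_self _).trans hbound]

end CyclotomicTournament

theorem corollary4p2 (m : ℕ) (hm : 0 < m) (hm_even : Even m) :
    ∃ K : ℝ, 0 < K ∧
      ∀ (p : ℕ) [Fact p.Prime], p ≡ m + 1 [MOD 2 * m] →
      ∀ g : (ZMod p)ˣ, (∀ u : (ZMod p)ˣ, u ∈ Subgroup.zpowers g) →
      ∀ i : Fin (m / 2) → Fin m,
        {x : ZMod p | x ≠ 0} \ CyclotomicTournament.cosetUnion m g i =
          -CyclotomicTournament.cosetUnion m g i →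
        (CyclotomicTournament.maxConsistentEdges
            (CyclotomicTournament.differenceDigraph
              (CyclotomicTournament.cosetUnion m g i)) : ℝ) ≤
          1 / 2 * (p.choose 2 : ℝ) + K * (p : ℝ) ^ (3 / 2 : ℝ) * Real.log p := by
  refine ⟨8 * m, by positivity, fun p _ hp g hg i hS => ?_⟩
  have hmp : m ∣ p - 1 := by
    have h1 : p ≡ 0 + 1 [MOD m] :=
      (hp.of_dvd (dvd_mul_left m 2)).trans ((Nat.modEq_zero_iff_dvd.2 dvd_rfl).add_right 1)
    exact (Nat.modEq_iff_dvd' (Fact.out : p.Prime).one_le).1 h1.symm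
  obtain ⟨σ, -, hσ⟩ := Finset.exists_mem_eq_sup Finset.univ
    ⟨Fintype.equivFin (ZMod p), Finset.mem_univ _⟩
    fun σ : ZMod p ≃ Fin (Fintype.card (ZMod p)) =>
      CyclotomicTournament.consistentEdges
        (CyclotomicTournament.differenceDigraph (CyclotomicTournament.cosetUnion m g i)) σ
  rw [CyclotomicTournament.maxConsistentEdges, hσ]
  exact CyclotomicTournament.consistentEdges_cosetUnion_le hm hmp hg i hS σ
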